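/- **Conventions.** Euclidean spaces carry the Euclidean norm, and all germs are germs at the origin. A germ of bi-Lipschitz homeomorphism $(\mathbb{R}^m,0)\to(\mathbb{R}^m,0)$ is a map-germ that is Lipschitz near $0$ and has an inverse germ that is Lipschitz near $0$. Two $C^\infty$ map-germs $f,g:(\mathbb{R}^n,0)\to(\mathbb{R}^p,0)$ are *bi-Lipschitz $\mathcal{A}$-equivalent* if $f=t\circ g\circ s$ for germs of bi-Lipschitz homeomorphisms $s$ of $(\mathbb{R}^n,0)$ and $t$ of $(\mathbb{R}^p,0)$. **$L$-stratifications.** A *stratification* of $\mathbb{R}^N$ is a filtration $X^0\subseteq X^1\subseteq\dots\subseteq X^N=\mathbb{R}^N$ by closed sets such that each $\mathring X^j=X^j\setminus X^{j-1}$ (with $X^{-1}=\emptyset$) is empty or a $C^\infty$ submanifold of pure dimension $j$; the connected components of the $\mathring X^j$ are its strata. Let $l$ be the least index with $X^l\ne\emptyset$, and let $c>1$. A *$c$-chain* for $q\in\mathring X^{j_1}$ consists of indices $j_1>j_2>\dots>j_r=l$ and points $q_{j_i}\in\mathring X^{j_i}$ with $q_{j_1}=q$ such that every $j_i$ $(i\ge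 2)$ is the greatest integer less than $j_{i-1}$ with $\mathrm{dist}(q,X^{j_i-1})\ge 2c^2\,\mathrm{dist}(q,X^{j_i})$ (regarded as fulfilled for $j_i=l$), and $|q-q_{j_i}|\le c\,\mathrm{dist}(q,X^{j_i})$. For $q\in\mathring X^j$ let $P_q$ be the orthogonal projection onto $T_q\mathring X^j$, and let $P_q^\perp=I-P_q$. In the next two inequalities $\mathrm{dist}(q,\emptyset)=1$. The stratification is an *$L$-stratification* if for some $c>1$ and every compact $K\subset\mathbb{R}^N$ there is a constant $C$ such that every $c$-chain as above with $q\in K$ satisfies $$|P_q^\perp P_{q_{j_2}}\cdots P_{q_{j_k}}|\le C\,\frac{|q-q_{j_2}|}{\mathrm{dist}(q,X^{j_k-1})}\qquad(2\le k\le r)$$ and, for all $q'\in\mathring X^{j_1}$ with $|q-q'|\le\frac1{2c}\mathrm{dist}(q,X^{j_1-1})$, $$|(P_q-P_{q'})P_{q_{j_2}}\cdots P_{q_{j_k}}|\le C\,\frac{|q-q'|}{\mathrm{dist}(q,X^{j_k-1})}\qquad(1\le k\le r),$$ where for $k=1$ the left-hand side is $|P_q-P_{q'}|$. A smooth map-germ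 is *stratified* with respect to stratifications of source and target if a representative on some open neighbourhood of $0$ maps each stratum (each connected component of the trace of $\mathring X^j$ on the neighbourhood) submersively into a stratum. A germ of *stratified Lipschitz vector field* is a germ of Lipschitz vector field that is tangent to the strata. **Lipschitz triviality.** Let $f:(\mathbb{R}^n,0)\to(\mathbb{R}^p,0)$ be a $C^\infty$ map-germ. A $C^\infty$ deformation-germ of $f$ is a $C^\infty$ map-germ $\Phi:(\mathbb{R}^n\times\mathbb{R}^k,(0,0))\to(\mathbb{R}^p,0)$ with $\Phi(x,0)=f(x)$. It is *Lipschitz trivial* if there are $L$-stratifications $\mathcal S$ of $\mathbb{R}^n\times\mathbb{R}^k$ and $\mathcal T$ of $\mathbb{R}^p\times\mathbb{R}^k$ such that, with $\pi(x,\lambda)=\lambda$ and $\pi'(y,\lambda)=\lambda$: (a) $(\Phi,\pi)$ is a stratified map-germ with respect to $\mathcal S$ and $\mathcal T$; (b) $\pi'$ is a stratified map-germ with respect to $\mathcal T$ and $\{\mathbb{R}^k\}$; (c) for $i=1,\dots,k$ there are germs at the origin of stratified Lipschitz vector fields $\xi_i+\frac{\partial}{\partial\lambda_i}$ with respect to $\mathcal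 S$ and $\eta_i+\frac{\partial}{\partial\lambda_i}$ with respect to $\mathcal T$, with $\xi_i$ and $\eta_i$ having components along $\mathbb{R}^n$ and $\mathbb{R}^p$ only, such that $d(\Phi,\pi)\bigl(\xi_i+\frac{\partial}{\partial\lambda_i}\bigr)=\bigl(\eta_i+\frac{\partial}{\partial\lambda_i}\bigr)\circ(\Phi,\pi)$ near the origin. **Theorem 1.** Let $f,g:(\mathbb{R}^n,0)\to(\mathbb{R}^p,0)$ be $C^\infty$ map-germs such that: (i) there are a germ of $C^\infty$ diffeomorphism $s:(\mathbb{R}^n,0)\to(\mathbb{R}^n,0)$ and a $C^\infty$ map-germ $M:(\mathbb{R}^n,0)\to(GL(p,\mathbb{R}),M(0))$ with $f(x)=M(x)\,g(s(x))$; (ii) $F:(\mathbb{R}^n\times\mathbb{R}^p,(0,0))\to(\mathbb{R}^p,0)$, $F(x,\lambda)=f(x)-M(x)\lambda$, is a Lipschitz trivial deformation-germ of $f$; (iii) $G:(\mathbb{R}^n\times\mathbb{R}^p,(0,0))\to(\mathbb{R}^p,0)$, $G(x,\lambda)=g(x)-M(s^{-1}(x))^{-1}\lambda$, is a Lipschitz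 trivial deformation-germ of $g$. Then $f$ and $g$ are bi-Lipschitz $\mathcal{A}$-equivalent. -/

import Mathlib

open scoped ContDiff Topology NNReal

noncomputable section

/-! ### Euclidean spaces and germs

A germ at a point is given by an everywhere defined representative; all conditions on it are
imposed on some neighbourhood of the point only. -/

/-- `ℝⁿ` with the Euclidean norm. -/
abbrev Euc (n : ℕ) : Type := EuclideanSpace ℝ (Fin n)

/-- `ℝⁿ × ℝᵏ` with the Euclidean norm: the coordinates of the first factor are indexed by
`Sum.inl`, those of the second factor by `Sum.inr`. -/
abbrev EucProd (n k : ℕ) : Type := EuclideanSpace ℝ (Fin n ⊕ Fin k)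

/-- The point `(x, y)` of `ℝⁿ × ℝᵏ`. -/
def pt {n k : ℕ} (x : Euc n) (y : Euc k) : EucProd n k := WithLp.toLp 2 (Sum.elim x y)

/-- The projection `ℝⁿ × ℝᵏ → ℝⁿ`. -/
def prFst {n k : ℕ} (z : EucProd n k) : Euc n := WithLp.toLp 2 fun i => z (Sum.inl i)

/-- The projection `ℝⁿ × ℝᵏ → ℝᵏ`. -/
def prSnd {n k : ℕ} (z : EucProd n k) : Euc k := WithLp.toLp 2 fun i => z (Sum.inr i)

/-- `f` is `C^∞` on some neighbourhood of `a`. -/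
def SmoothNear {E F : Type*} [NormedAddCommGroup E] [NormedSpace ℝ E]
    [NormedAddCommGroup F] [NormedSpace ℝ F] (f : E → F) (a : E) : Prop :=
  ∃ U ∈ 𝓝 a, ContDiffOn ℝ ∞ f U

/-- `f` represents a `C^∞` map-germ `(E, 0) → (F, 0)`. -/
def IsSmoothMapGerm {E F : Type*} [NormedAddCommGroup E] [NormedSpace ℝ E]
    [NormedAddCommGroup F] [NormedSpace ℝ F] (f : E → F) : Prop :=
  SmoothNear f 0 ∧ f 0 = 0

/-- `s` represents a germ of `C^∞` diffeomorphism `(E, 0) → (E, 0)`, with inverse germ `s'`. -/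
def IsSmoothDiffeoGerm {E : Type*} [NormedAddCommGroup E] [NormedSpace ℝ E]
    (s s' : E → E) : Prop :=
  IsSmoothMapGerm s ∧ IsSmoothMapGerm s' ∧
    (∀ᶠ x in 𝓝 0, s' (s x) = x) ∧ (∀ᶠ x in 𝓝 0, s (s' x) = x)

/-- `f` is Lipschitz on some neighbourhood of `a`. -/
def LipschitzNear {E F : Type*} [NormedAddCommGroup E] [NormedAddCommGroup F]
    (f : E → F) (a : E) : Prop :=
  ∃ U ∈ 𝓝 a, ∃ K : ℝ≥0, LipschitzOnWith K f U

/-- `s` represents a germ of bi-Lipschitz homeomorphism `(E, 0) → (E, 0)`. -/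
def IsBiLipschitzGerm {E : Type*} [NormedAddCommGroup E] (s : E → E) : Prop :=
  s 0 = 0 ∧ LipschitzNear s 0 ∧ ∃ s' : E → E, s' 0 = 0 ∧ LipschitzNear s' 0 ∧
    (∀ᶠ x in 𝓝 0, s' (s x) = x) ∧ (∀ᶠ x in 𝓝 0, s (s' x) = x)

/-- Bi-Lipschitz `𝒜`-equivalence of map-germs: `f = t ∘ g ∘ s` as germs at `0`. -/
def BiLipschitzAEquivalent {n p : ℕ} (f g : Euc n → Euc p) : Prop :=
  ∃ (s : Euc n → Euc n) (t : Euc p → Euc p), IsBiLipschitzGerm s ∧ IsBiLipschitzGerm t ∧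
    ∀ᶠ x in 𝓝 0, f x = t (g (s x))

/-! ### Submanifolds and stratifications -/

/-- `A` is a (not necessarily closed) `C^∞` submanifold of `E` of pure dimension `d`: locally a
`C^∞` diffeomorphism between open subsets of `E` straightens `A` to a `d`-dimensional linear
subspace. The empty set is a submanifold of every dimension. -/
def IsSmoothSubmanifold {E : Type*} [NormedAddCommGroup E] [NormedSpace ℝ E]
    (A : Set E) (d : ℕ) : Prop :=
  ∀ q ∈ A, ∃ (φ : OpenPartialHomeomorph E E) (V : Submodule ℝ E),
    q ∈ φ.source ∧ Module.finrank ℝ V = d ∧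
    ContDiffOn ℝ ∞ φ φ.source ∧ ContDiffOn ℝ ∞ φ.symm φ.target ∧
    ∀ x ∈ φ.source, x ∈ A ↔ φ x ∈ V

/-- The tangent space `T_q A` of a submanifold `A` at `q ∈ A`, as a linear subspace of `E`. -/
def tangentSpaceOf {E : Type*} [NormedAddCommGroup E] [NormedSpace ℝ E]
    (A : Set E) (q : E) : Submodule ℝ E :=
  Submodule.span ℝ (tangentConeAt ℝ A q)

/-- A stratification of the space `E`, as a filtration `X⁰ ⊆ X¹ ⊆ … ⊆ X^{dim E} = E` by closed
sets such that each `X^j \ X^{j-1}` is empty or a `C^∞` submanifold of pure dimension `j`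
(here `X^{-1} = ∅`). -/
structure Stratification (E : Type*) [NormedAddCommGroup E] [NormedSpace ℝ E] where
  /-- the skeleton `X^j` -/
  skel : ℕ → Set E
  mono : Monotone skel
  isClosed_skel : ∀ j, IsClosed (skel j)
  skel_finrank : skel (Module.finrank ℝ E) = Set.univ
  smooth : ∀ j, IsSmoothSubmanifold (skel j \ ⋃ i < j, skel i) j

namespace Stratification

variable {E : Type*} [NormedAddCommGroup E]

/-- `X^{j-1}`, which is empty for `j = 0`. -/
def below [NormedSpace ℝ E] (X : Stratification E) (j : ℕ) : Set E := ⋃ i < j, X.skel i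

/-- The union `X^j \ X^{j-1}` of the strata of dimension `j`. The strata of dimension `j` are its
connected components. -/
def stratum [NormedSpace ℝ E] (X : Stratification E) (j : ℕ) : Set E := X.skel j \ X.below j

/-- The distance `dist(q, X^{j-1})`, with the convention `dist(q, ∅) = 1`. -/
def distBelow [NormedSpace ℝ E] (X : Stratification E) (q : E) (j : ℕ) : ℝ :=
  open Classical in if X.below j = ∅ then 1 else Metric.infDist q (X.below j)

/-- `X^l` is the smallest nonempty skeleton. -/
def IsBottom [NormedSpace ℝ E] (X : Stratification E) (l : ℕ) : Prop :=
  (X.skel l).Nonempty ∧ X.below l = ∅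

/-- The gap condition `dist(q, X^{i-1}) ≥ 2 c² dist(q, X^i)`, which is regarded as fulfilled at
the bottom of the filtration. -/
def Gap [NormedSpace ℝ E] (X : Stratification E) (c : ℝ) (q : E) (i : ℕ) : Prop :=
  X.IsBottom i ∨
    ((X.below i).Nonempty ∧
      2 * c ^ 2 * Metric.infDist q (X.skel i) ≤ Metric.infDist q (X.below i))

/-- The points `q 0, q 1, …, q r` form a `c`-chain for `q 0`, with indices `j 0 > j 1 > … > j r`:
`q s` lies in `X^{j s} \ X^{j s - 1}`, at distance at most `c * dist(q 0, X^{j s})` from `q 0`,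
every `j (s + 1)` is the greatest integer less than `j s` that satisfies the gap condition at
`q 0`, and `j r` is the bottom index. Values at arguments larger than `r` are irrelevant. -/
structure IsChain [NormedSpace ℝ E] (X : Stratification E) (c : ℝ) (r : ℕ) (j : ℕ → ℕ)
    (q : ℕ → E) : Prop where
  mem : ∀ s ≤ r, q s ∈ X.stratum (j s)
  near : ∀ s ≤ r, ‖q 0 - q s‖ ≤ c * Metric.infDist (q 0) (X.skel (j s))
  next : ∀ s < r, IsGreatest {i | i < j s ∧ X.Gap c (q 0) i} (j (s + 1))
  bottom : X.IsBottom (j r)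

/-- The orthogonal projection `P_q` of `E` onto the tangent space at `q` of the stratum of
dimension `j` (for `q` in that stratum). -/
def proj [InnerProductSpace ℝ E] [FiniteDimensional ℝ E] (X : Stratification E) (j : ℕ) (q : E) :
    E →L[ℝ] E :=
  (tangentSpaceOf (X.stratum j) q).starProjection

/-- The product `P_{q 1} P_{q 2} ⋯ P_{q k}` of projections along a chain (the identity for
`k = 0`). -/
def projProd [InnerProductSpace ℝ E] [FiniteDimensional ℝ E] (X : Stratification E)
    (j : ℕ → ℕ) (q : ℕ → E) : ℕ → (E →L[ℝ] E)
  | 0 => ContinuousLinearMap.id ℝ E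
  | k + 1 => (projProd X j q k).comp (X.proj (j (k + 1)) (q (k + 1)))

/-- `L`-stratifications (Lipschitz stratifications of Mostowski, in Parusiński's form): for some
`c > 1` and, locally uniformly, some constant `C`, every chain `q = q 0, q 1, …, q r` satisfies
`|P_q^⊥ P_{q 1} ⋯ P_{q k}| ≤ C |q - q 1| / dist(q, X^{j k - 1})` for `1 ≤ k ≤ r`, and
`|(P_q - P_{q'}) P_{q 1} ⋯ P_{q k}| ≤ C |q - q'| / dist(q, X^{j k - 1})` for `0 ≤ k ≤ r` and all
`q'` in `X^{j 0} \ X^{j 0 - 1}` with `|q - q'| ≤ dist(q, X^{j 0 - 1}) / (2 c)`. -/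
def IsLStratification [InnerProductSpace ℝ E] [FiniteDimensional ℝ E]
    (X : Stratification E) : Prop :=
  ∃ c : ℝ, 1 < c ∧ ∀ K : Set E, IsCompact K → ∃ C : ℝ,
    ∀ (r : ℕ) (j : ℕ → ℕ) (q : ℕ → E), X.IsChain c r j q → q 0 ∈ K →
      (∀ k, 1 ≤ k → k ≤ r →
        ‖(ContinuousLinearMap.id ℝ E - X.proj (j 0) (q 0)).comp (X.projProd j q k)‖
          ≤ C * ‖q 0 - q 1‖ / X.distBelow (q 0) (j k)) ∧
      (∀ q' ∈ X.stratum (j 0), ‖q 0 - q'‖ ≤ X.distBelow (q 0) (j 0) / (2 * c) →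
        ∀ k ≤ r,
          ‖(X.proj (j 0) (q 0) - X.proj (j 0) q').comp (X.projProd j q k)‖
            ≤ C * ‖q 0 - q'‖ / X.distBelow (q 0) (j k))

/-- The stratification of `E` with `E` as its only stratum. -/
def trivial (E : Type*) [NormedAddCommGroup E] [NormedSpace ℝ E] : Stratification E where
  skel j := {_x | Module.finrank ℝ E ≤ j}
  mono := fun _ _ h _ hx => le_trans hx h
  isClosed_skel _ := isClosed_const
  skel_finrank := by simp
  smooth := by
    intro j q hq
    have hj : Module.finrank ℝ E = j := by
      simp only [Set.mem_sdiff, Set.mem_ofPred_eq, Set.mem_iUnion, not_exists] at hq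
      refine le_antisymm hq.1 ?_
      by_contra h
      exact hq.2 _ (not_le.mp h) le_rfl
    refine ⟨OpenPartialHomeomorph.refl E, ⊤, by simp, by simpa using hj,
      contDiff_id.contDiffOn, contDiff_id.contDiffOn, ?_⟩
    intro x _
    simp only [Set.mem_sdiff, Set.mem_ofPred_eq, Set.mem_iUnion, Submodule.mem_top, iff_true]
      at hq ⊢
    exact hq

end Stratification

/-- `f : (E, 0) → (F, 0)` represents a stratified map-germ with respect to `S` and `T`: on some open
neighbourhood `U` of `0`, `f` is `C^∞` and maps every stratum submersively into a stratum. -/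
def IsStratifiedMapGerm {E F : Type*} [NormedAddCommGroup E] [NormedSpace ℝ E]
    [NormedAddCommGroup F] [NormedSpace ℝ F]
    (f : E → F) (S : Stratification E) (T : Stratification F) : Prop :=
  f 0 = 0 ∧ ∃ U : Set E, IsOpen U ∧ 0 ∈ U ∧ ContDiffOn ℝ ∞ f U ∧
    ∀ j, ∀ q ∈ S.stratum j ∩ U, ∃ i, ∀ x ∈ connectedComponentIn (S.stratum j ∩ U) q,
      f x ∈ T.stratum i ∧
      (tangentSpaceOf (S.stratum j) x).map (fderiv ℝ f x : E →ₗ[ℝ] F)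
        = tangentSpaceOf (T.stratum i) (f x)

/-- `v` represents a germ at `0` of stratified Lipschitz vector field with respect to `S`:
it is Lipschitz and tangent to the strata near `0`. -/
def IsStratifiedLipschitzField {E : Type*} [NormedAddCommGroup E] [NormedSpace ℝ E]
    (S : Stratification E) (v : E → E) : Prop :=
  LipschitzNear v 0 ∧ ∀ᶠ x in 𝓝 0, ∀ j, x ∈ S.stratum j → v x ∈ tangentSpaceOf (S.stratum j) x

/-- The germ at `0` of the vector field `v` lifts that of `w` with respect to `f`. -/
def Lifts {E F : Type*} [NormedAddCommGroup E] [NormedSpace ℝ E]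
    [NormedAddCommGroup F] [NormedSpace ℝ F] (f : E → F) (v : E → E) (w : F → F) : Prop :=
  ∀ᶠ x in 𝓝 0, fderiv ℝ f x (v x) = w (f x)

/-! ### Deformations and Lipschitz triviality -/

/-- `Φ` represents a `C^∞` deformation-germ of `f` with parameter space `ℝᵏ`. -/
def IsDeformationGerm {n p k : ℕ} (f : Euc n → Euc p) (Φ : EucProd n k → Euc p) : Prop :=
  IsSmoothMapGerm Φ ∧ ∀ᶠ x in 𝓝 0, Φ (pt x 0) = f x

/-- The map `(Φ, π) : (x, l) ↦ (Φ (x, l), l)`. -/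
def withParam {n p k : ℕ} (Φ : EucProd n k → Euc p) : EucProd n k → EucProd p k :=
  fun z => pt (Φ z) (prSnd z)

/-- The vector field `ξ + ∂/∂λ_i` on `ℝⁿ × ℝᵏ`, where `ξ` has components along `ℝⁿ` only. -/
def addParamField {n k : ℕ} (ξ : EucProd n k → Euc n) (i : Fin k) : EucProd n k → EucProd n k :=
  fun z => pt (ξ z) (EuclideanSpace.single i 1)

/-- `Φ` is a Lipschitz trivial deformation-germ of `f`. -/
def IsLipschitzTrivial {n p k : ℕ} (f : Euc n → Euc p) (Φ : EucProd n k → Euc p) : Prop :=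
  IsDeformationGerm f Φ ∧
  ∃ (S : Stratification (EucProd n k)) (T : Stratification (EucProd p k)),
    S.IsLStratification ∧ T.IsLStratification ∧
    IsStratifiedMapGerm (withParam Φ) S T ∧
    IsStratifiedMapGerm (fun z : EucProd p k => prSnd z) T (Stratification.trivial (Euc k)) ∧
    ∃ (ξ : Fin k → EucProd n k → Euc n) (η : Fin k → EucProd p k → Euc p), ∀ i,
      IsStratifiedLipschitzField S (addParamField (ξ i) i) ∧
      IsStratifiedLipschitzField T (addParamField (η i) i) ∧
      Lifts (withParam Φ) (addParamField (ξ i) i) (addParamField (η i) i)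

end

noncomputable section

/-! ### Flows of the fields `v · l`, for `v` Lipschitz and `l` a small parameter -/

section Flows

open Set Metric Filter

/-! Integrating the Lipschitz fields trivialises both deformations: F(h₁(w,λ),λ) = κ₁(f(w),λ) and
G(h₂(w,λ),λ) = κ₂(g(w),λ). The two deformations exchange the roles of value and parameter: if F(x,λ)
= μ, then M(x)(g(s(x)) - λ) = μ, that is, G(s(x),μ) = λ. Take x = h₁(w,λ), μ = κ₁(f(w),λ) and z with
h₂(z,μ) = s(x); then κ₂(g(z),μ) = λ, so g(z) is a function of λ and μ alone. Choosing λ = C f(w)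
with C linear makes μ, hence g(z), a function θ of f(w), and g ∘ z = θ ∘ f. It remains to choose C
so that z and θ are bi-Lipschitz.

A Lipschitz flow need not be differentiable in its starting point, but the field v · l has Lipschitz
constant proportional to |l|. Its time-one map is therefore strictly differentiable in (start, l) at
the origin (`exists_flow_hasStrictFDerivAt`), and the inverse function theorem applies there. With
H₁ and H₂ the parameter derivatives of κ₁ and κ₂, dθ = (1 - H₂H₁)C - H₂, and some C makes this
injective because the ranges of 1 - H₂H₁ and H₂ span (`exists_injective_one_sub_mul_sub`).
Differentiating g ∘ z = θ ∘ f then shows that dz is injective too. -/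

theorem exists_integralCurve_mem_closedBall {E : Type*} [NormedAddCommGroup E] [NormedSpace ℝ E]
    [CompleteSpace E] {f : E → E} {x₀ : E} {a K : ℝ≥0}
    (hl : LipschitzOnWith K f (closedBall x₀ a)) (hb : ∀ x ∈ closedBall x₀ a, ‖f x‖ ≤ a) :
    ∃ α : ℝ → E, α 0 = x₀ ∧ ∀ t ∈ Icc (0 : ℝ) 1,
      α t ∈ closedBall x₀ a ∧ HasDerivWithinAt α (f (α t)) (Icc 0 1) t := by
  -- Speed at most `a` for unit time cannot leave the ball of radius `a`. The Picard fixed point is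
  -- taken directly, since its function space records this confinement.
  have hm : (a : ℝ) * max (1 - 0) (0 - 0) ≤ a - (0 : ℝ≥0) := by simp
  have hf : IsPicardLindelof (fun _ ↦ f) (⟨0, by simp⟩ : Icc (0 : ℝ) 1) x₀ a 0 a K :=
    .of_time_independent hb hl hm
  obtain ⟨α, hα⟩ := ODE.FunSpace.exists_isFixedPt_next hf (mem_closedBall_self le_rfl)
  refine ⟨α.compProj, ?_, fun t ht ↦ ⟨α.compProj_mem_closedBall hf.mul_max_le, ?_⟩⟩
  · have := ODE.FunSpace.compProj_val (α := α) (t := (⟨0, by simp⟩ : Icc (0 : ℝ) 1))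
    rw [this, ← hα, ODE.FunSpace.next_apply₀]
  · apply ODE.hasDerivWithinAt_picard_Icc (⟨0, by simp⟩ : Icc (0 : ℝ) 1).2 hf.continuousOn_uncurry
      α.continuous_compProj.continuousOn (fun _ ht' ↦ α.compProj_mem_closedBall hf.mul_max_le)
      x₀ ht |>.congr_of_mem _ ht
    intro t' ht'
    nth_rw 1 [← hα]
    rw [ODE.FunSpace.compProj_of_mem ht', ODE.FunSpace.next_apply]

variable {Z P : Type*} [NormedAddCommGroup Z] [NormedSpace ℝ Z] [NormedAddCommGroup P]
  [NormedSpace ℝ P]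

/-- Two integral curves of the fields `v · l₁` and `v · l₂` on `[0, 1]` stay close to each other, up
to the linear term, when `v` is Lipschitz and `l₂` is small. -/
theorem norm_sub_sub_le_of_integralCurves {v : Z → P →L[ℝ] Z} {K : ℝ≥0} {S : Set Z} {B ε : ℝ}
    (hl : LipschitzOnWith K v S) (hB : ∀ z ∈ S, ‖v z‖ ≤ B) (h0 : (0 : Z) ∈ S)
    {l₁ l₂ : P} {γ₁ γ₂ : ℝ → Z}
    (h₁ : ∀ t ∈ Icc (0 : ℝ) 1, γ₁ t ∈ S ∧ HasDerivWithinAt γ₁ (v (γ₁ t) l₁) (Icc 0 1) t)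
    (h₂ : ∀ t ∈ Icc (0 : ℝ) 1, γ₂ t ∈ S ∧ HasDerivWithinAt γ₂ (v (γ₂ t) l₂) (Icc 0 1) t)
    (hε : ∀ t ∈ Icc (0 : ℝ) 1, ‖γ₁ t‖ ≤ ε) (hl₂ : ‖l₂‖ ≤ ε) (hKε : K * ε ≤ 1 / 2) :
    ‖γ₁ 1 - γ₂ 1 - (γ₁ 0 - γ₂ 0) - v 0 (l₁ - l₂)‖
      ≤ K * ε * (‖l₁ - l₂‖ + 2 * (‖γ₁ 0 - γ₂ 0‖ + B * ‖l₁ - l₂‖)) := by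
  have hK : (0 : ℝ) ≤ K := K.2
  have h0I : (0 : ℝ) ∈ Icc (0 : ℝ) 1 := by simp
  have h1I : (1 : ℝ) ∈ Icc (0 : ℝ) 1 := by simp
  have hε0 : 0 ≤ ε := (norm_nonneg _).trans hl₂
  have hv : ∀ x ∈ S, ∀ y ∈ S, ‖v x - v y‖ ≤ K * ‖x - y‖ := fun x hx y hy ↦
    hl.norm_sub_le hx hy
  have hd : ∀ t ∈ Icc (0 : ℝ) 1, HasDerivWithinAt (fun t ↦ γ₁ t - γ₂ t)
      (v (γ₁ t) l₁ - v (γ₂ t) l₂) (Icc 0 1) t := fun t ht ↦ (h₁ t ht).2.sub (h₂ t ht).2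
  have hdc : ContinuousOn (fun t ↦ ‖γ₁ t - γ₂ t‖) (Icc 0 1) :=
    ContinuousOn.norm fun t ht ↦ (hd t ht).continuousWithinAt
  obtain ⟨τ, hτ, hmax⟩ := isCompact_Icc.exists_isMaxOn ⟨0, h0I⟩ hdc
  set m := ‖γ₁ τ - γ₂ τ‖
  have hmax' : ∀ t ∈ Icc (0 : ℝ) 1, ‖γ₁ t - γ₂ t‖ ≤ m := fun t ht ↦ hmax ht
  have hm0 : 0 ≤ m := norm_nonneg _
  have hdiff : ∀ t ∈ Icc (0 : ℝ) 1, ‖(v (γ₁ t) - v (γ₂ t)) l₂‖ ≤ K * ε * m := fun t ht ↦ by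
    calc _ ≤ ‖v (γ₁ t) - v (γ₂ t)‖ * ‖l₂‖ := ContinuousLinearMap.le_opNorm _ _
      _ ≤ (K * m) * ε := by
        gcongr
        exact (hv _ (h₁ t ht).1 _ (h₂ t ht).1).trans (by gcongr; exact hmax' t ht)
      _ = _ := by ring
  have hb1 : ∀ t ∈ Icc (0 : ℝ) 1, ‖v (γ₁ t) l₁ - v (γ₂ t) l₂‖ ≤ B * ‖l₁ - l₂‖ + K * ε * m :=
    fun t ht ↦ by
    have : v (γ₁ t) l₁ - v (γ₂ t) l₂ = v (γ₁ t) (l₁ - l₂) + (v (γ₁ t) - v (γ₂ t)) l₂ := by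
      simp
    rw [this]
    refine (norm_add_le _ _).trans (add_le_add ?_ (hdiff t ht))
    exact (ContinuousLinearMap.le_opNorm _ _).trans (by gcongr; exact hB _ (h₁ t ht).1)
  have hB0 : 0 ≤ B := (norm_nonneg _).trans (hB 0 h0)
  -- The maximal distance `m` occurs on both sides of the mean value estimate; `K * ε ≤ 1 / 2` lets
  -- the right-hand occurrence be absorbed.
  have hmle : m ≤ 2 * (‖γ₁ 0 - γ₂ 0‖ + B * ‖l₁ - l₂‖) := by
    have h := (convex_Icc (0 : ℝ) 1).norm_image_sub_le_of_norm_hasDerivWithin_le hd hb1 h0I hτ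
    have h' : ‖τ - 0‖ ≤ 1 := by
      rw [sub_zero, Real.norm_of_nonneg hτ.1]; exact hτ.2
    have h2 : m ≤ ‖γ₁ 0 - γ₂ 0‖ + (B * ‖l₁ - l₂‖ + K * ε * m) := by
      have h3 := norm_le_norm_add_norm_sub' (γ₁ τ - γ₂ τ) (γ₁ 0 - γ₂ 0)
      have h4 : (B * ‖l₁ - l₂‖ + K * ε * m) * ‖τ - 0‖ ≤ (B * ‖l₁ - l₂‖ + K * ε * m) * 1 := by
        gcongr
      linarith
    have h5 : K * ε * m ≤ 1 / 2 * m := by gcongr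
    linarith
  -- With the linear drift removed, every remaining term of the velocity carries the small factor `K
  -- * ε`.
  have he : ∀ t ∈ Icc (0 : ℝ) 1, HasDerivWithinAt (fun t ↦ γ₁ t - γ₂ t - t • v 0 (l₁ - l₂))
      (v (γ₁ t) l₁ - v (γ₂ t) l₂ - (1 : ℝ) • v 0 (l₁ - l₂)) (Icc 0 1) t := fun t ht ↦
    (hd t ht).sub ((hasDerivWithinAt_id t _).smul_const _)
  have hb2 : ∀ t ∈ Icc (0 : ℝ) 1, ‖v (γ₁ t) l₁ - v (γ₂ t) l₂ - (1 : ℝ) • v 0 (l₁ - l₂)‖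
      ≤ K * ε * ‖l₁ - l₂‖ + K * ε * m := fun t ht ↦ by
    have : v (γ₁ t) l₁ - v (γ₂ t) l₂ - (1 : ℝ) • v 0 (l₁ - l₂)
        = (v (γ₁ t) - v 0) (l₁ - l₂) + (v (γ₁ t) - v (γ₂ t)) l₂ := by
      simp; abel
    rw [this]
    refine (norm_add_le _ _).trans (add_le_add ?_ (hdiff t ht))
    refine (ContinuousLinearMap.le_opNorm _ _).trans ?_
    gcongr
    refine (hv _ (h₁ t ht).1 _ h0).trans ?_
    rw [sub_zero]
    gcongr
    exact hε t ht
  have h := (convex_Icc (0 : ℝ) 1).norm_image_sub_le_of_norm_hasDerivWithin_le he hb2 h0I h1I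
  have h6 : γ₁ 1 - γ₂ 1 - (1 : ℝ) • v 0 (l₁ - l₂) - (γ₁ 0 - γ₂ 0 - (0 : ℝ) • v 0 (l₁ - l₂))
      = γ₁ 1 - γ₂ 1 - (γ₁ 0 - γ₂ 0) - v 0 (l₁ - l₂) := by
    rw [one_smul, zero_smul]; abel
  rw [h6] at h
  refine h.trans ?_
  rw [sub_zero, norm_one, mul_one, mul_add]
  gcongr

/-- The time-one flow of the vector fields `v · l`, for a Lipschitz `v`, is strictly differentiable
at the origin as a function of the starting point and of the parameter `l`. -/
theorem exists_flow_hasStrictFDerivAt [CompleteSpace Z] {v : Z → P →L[ℝ] Z}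
    (hv : LipschitzNear v 0) :
    ∃ Γ : Z × P → ℝ → Z,
      (∀ᶠ w in 𝓝 0, Γ w 0 = w.1 ∧
        ∀ t ∈ Icc (0 : ℝ) 1, HasDerivWithinAt (Γ w) (v (Γ w t) w.2) (Icc 0 1) t) ∧
      (∃ C : ℝ, ∀ᶠ w in 𝓝 0, ∀ t ∈ Icc (0 : ℝ) 1, ‖Γ w t‖ ≤ C * ‖w‖) ∧
      HasStrictFDerivAt (fun w ↦ Γ w 1)
        (ContinuousLinearMap.fst ℝ Z P + (v 0).comp (ContinuousLinearMap.snd ℝ Z P)) 0 := by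
  obtain ⟨U, hU, K, hK⟩ := hv
  obtain ⟨ρ, hρ, hρU⟩ := Metric.mem_nhds_iff.1 hU
  replace hK := hK.mono hρU
  set B : ℝ≥0 := ‖v 0‖₊ + K * ⟨ρ, hρ.le⟩ 
  have h0 : (0 : Z) ∈ ball (0 : Z) ρ := mem_ball_self hρ
  have hB : ∀ z ∈ ball (0 : Z) ρ, ‖v z‖ ≤ B := fun z hz ↦ by
    have h1 := hK.norm_sub_le hz h0
    have h2 := norm_le_norm_add_norm_sub' (v z) (v 0)
    have h3 : ‖z - 0‖ ≤ ρ := by simpa using (mem_ball_zero_iff.1 hz).le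
    have h4 : (K : ℝ) * ‖z - 0‖ ≤ K * ρ := by gcongr
    have h5 : (B : ℝ) = ‖v 0‖ + K * ρ := rfl
    rw [h5]; linarith
  have hsmall : ∀ᶠ w : Z × P in 𝓝 0, (1 + B) * ‖w‖ < ρ := by
    have : Tendsto (fun w : Z × P ↦ (1 + B) * ‖w‖) (𝓝 0) (𝓝 ((1 + B) * ‖(0 : Z × P)‖)) :=
      (continuous_const.mul continuous_norm).tendsto 0
    exact this.eventually (gt_mem_nhds (by simpa using hρ))
  have hex : ∀ w : Z × P, (1 + B) * ‖w‖ < ρ → ∃ γ : ℝ → Z, γ 0 = w.1 ∧ ∀ t ∈ Icc (0 : ℝ) 1,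
      ‖γ t‖ ≤ (1 + B) * ‖w‖ ∧ HasDerivWithinAt γ (v (γ t) w.2) (Icc 0 1) t := by
    intro w hw
    -- The speed is at most `B * ‖w.2‖`, so this is the radius of confinement in unit time.
    have hsub : ∀ z ∈ closedBall w.1 ((B * ‖w.2‖₊ : ℝ≥0) : ℝ), ‖z‖ ≤ (1 + B) * ‖w‖ := by
      intro z hz
      rw [mem_closedBall_iff_norm] at hz
      have h1 := norm_le_norm_add_norm_sub' z w.1
      have h2 : ((B * ‖w.2‖₊ : ℝ≥0) : ℝ) ≤ B * ‖w‖ := by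
        push_cast; gcongr; exact norm_snd_le w
      have h3 := norm_fst_le w
      rw [add_mul, one_mul]; linarith
    have hsub' : closedBall w.1 ((B * ‖w.2‖₊ : ℝ≥0) : ℝ) ⊆ ball 0 ρ := fun z hz ↦
      mem_ball_zero_iff.2 ((hsub z hz).trans_lt hw)
    have hlip : LipschitzOnWith (K * ‖w.2‖₊) (fun z ↦ v z w.2)
        (closedBall w.1 ((B * ‖w.2‖₊ : ℝ≥0) : ℝ)) := by
      refine LipschitzOnWith.of_dist_le_mul fun x hx y hy ↦ ?_
      rw [dist_eq_norm, dist_eq_norm, ← sub_apply]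
      refine (ContinuousLinearMap.le_opNorm _ _).trans ?_
      push_cast
      rw [mul_right_comm]
      gcongr
      exact hK.norm_sub_le (hsub' hx) (hsub' hy)
    obtain ⟨γ, hγ0, hγ⟩ := exists_integralCurve_mem_closedBall hlip fun z hz ↦ by
      push_cast
      exact (ContinuousLinearMap.le_opNorm _ _).trans (by gcongr; exact hB _ (hsub' hz))
    exact ⟨γ, hγ0, fun t ht ↦ ⟨hsub _ (hγ t ht).1, (hγ t ht).2⟩⟩
  choose! Γ hΓ0 hΓ using hex
  refine ⟨Γ, hsmall.mono fun w hw ↦ ⟨hΓ0 w hw, fun t ht ↦ (hΓ w hw t ht).2⟩,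
    ⟨1 + B, hsmall.mono fun w hw t ht ↦ (hΓ w hw t ht).1⟩, ?_⟩
  rw [hasStrictFDerivAt_iff_isLittleO, Asymptotics.isLittleO_iff]
  intro c hc
  have hεlim : Tendsto (fun w : Z × P ↦ K * ((1 + B) * ‖w‖)) (𝓝 0) (𝓝 0) := by
    have : Continuous fun w : Z × P ↦ K * ((1 + B) * ‖w‖) := by fun_prop
    simpa using this.tendsto 0
  -- The bound `1 / 2` permits the absorption above; `3 + 2 * B` is the total factor 1 + 2(1 + B) of
  -- ‖w₁ - w₂‖ in the resulting estimate.
  have hε1 : ∀ᶠ w : Z × P in 𝓝 0, K * ((1 + B) * ‖w‖) < min (1 / 2) (c / (3 + 2 * B)) :=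
    hεlim.eventually (gt_mem_nhds (lt_min (by norm_num) (by positivity)))
  have hgood := hsmall.and hε1
  filter_upwards [hgood.prod_nhds hgood] with ⟨w₁, w₂⟩ ⟨⟨hw₁, hw₁'⟩, ⟨hw₂, hw₂'⟩⟩
  simp only at hw₁ hw₂ hw₁' hw₂' ⊢
  set r := max ‖w₁‖ ‖w₂‖
  have hr : K * ((1 + B) * r) ≤ min (1 / 2) (c / (3 + 2 * B)) := by
    rcases max_cases ‖w₁‖ ‖w₂‖ with ⟨h, -⟩ | ⟨h, -⟩
    · simpa only [r, h] using hw₁'.le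
    · simpa only [r, h] using hw₂'.le
  have key := norm_sub_sub_le_of_integralCurves (ε := (1 + B) * r) hK hB h0
    (fun t ht ↦ ⟨mem_ball_zero_iff.2 ((hΓ w₁ hw₁ t ht).1.trans_lt hw₁), (hΓ w₁ hw₁ t ht).2⟩)
    (fun t ht ↦ ⟨mem_ball_zero_iff.2 ((hΓ w₂ hw₂ t ht).1.trans_lt hw₂), (hΓ w₂ hw₂ t ht).2⟩)
    (fun t ht ↦ (hΓ w₁ hw₁ t ht).1.trans (by gcongr; exact le_max_left _ _))
    (((norm_snd_le w₂).trans (le_max_right ‖w₁‖ ‖w₂‖)).trans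
      (le_mul_of_one_le_left (by positivity) (by simp)))
    (hr.trans (min_le_left _ _))
  rw [hΓ0 w₁ hw₁, hΓ0 w₂ hw₂] at key
  have e : Γ w₁ 1 - Γ w₂ 1 - (ContinuousLinearMap.fst ℝ Z P +
      (v 0).comp (ContinuousLinearMap.snd ℝ Z P)) (w₁ - w₂)
      = Γ w₁ 1 - Γ w₂ 1 - (w₁.1 - w₂.1) - v 0 (w₁.2 - w₂.2) := by
    simp only [add_apply, ContinuousLinearMap.coe_fst',
      ContinuousLinearMap.comp_apply, ContinuousLinearMap.coe_snd', Prod.fst_sub, Prod.snd_sub]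
    abel
  rw [e]
  refine key.trans ?_
  have hn1 : ‖w₁.1 - w₂.1‖ ≤ ‖w₁ - w₂‖ := norm_fst_le (w₁ - w₂)
  have hn2 : ‖w₁.2 - w₂.2‖ ≤ ‖w₁ - w₂‖ := norm_snd_le (w₁ - w₂)
  calc _ ≤ c / (3 + 2 * B) * (‖w₁ - w₂‖ + 2 * (‖w₁ - w₂‖ + B * ‖w₁ - w₂‖)) := by
        gcongr
        exact hr.trans (min_le_right _ _)
    _ = c * ‖w₁ - w₂‖ := by field_simp; ring

end Flows

section Lipschitz

variable {E F G : Type*} [NormedAddCommGroup E] [NormedAddCommGroup F] [NormedSpace ℝ F]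
  [NormedAddCommGroup G] [NormedSpace ℝ G]

theorem LipschitzNear.clm_comp {f : E → F} {a : E} (hf : LipschitzNear f a) (T : F →L[ℝ] G) :
    LipschitzNear (fun x ↦ T (f x)) a :=
  let ⟨U, hU, _, hK⟩ := hf
  ⟨U, hU, _, T.lipschitz.comp_lipschitzOnWith hK⟩

theorem LipschitzNear.sum {E F ι : Type*} [NormedAddCommGroup E] [NormedAddCommGroup F]
    {f : ι → E → F} {a : E} (s : Finset ι)
    (hf : ∀ i ∈ s, LipschitzNear (f i) a) : LipschitzNear (fun x ↦ ∑ i ∈ s, f i x) a := by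
  classical
  induction s using Finset.induction_on with
  | empty => exact ⟨Set.univ, Filter.univ_mem, 0, by simp⟩
  | insert i s hi ih =>
    obtain ⟨U, hU, K, hK⟩ := hf i (Finset.mem_insert_self i s)
    obtain ⟨V, hV, L, hL⟩ := ih fun j hj ↦ hf j (Finset.mem_insert_of_mem hj)
    refine ⟨U ∩ V, Filter.inter_mem hU hV, K + L, ?_⟩
    simp only [Finset.sum_insert hi]
    exact (hK.mono Set.inter_subset_left).add (hL.mono Set.inter_subset_right)

end Lipschitz

/-! ### Related vector fields have conjugate flows -/

section Conjugacy

open Set Filter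

variable {Z Z' P : Type*} [NormedAddCommGroup Z] [NormedSpace ℝ Z] [NormedAddCommGroup Z']
  [NormedSpace ℝ Z'] [NormedAddCommGroup P] [NormedSpace ℝ P]

theorem eventually_forall_Icc_of_norm_le {Z P : Type*} [NormedAddCommGroup Z]
    [NormedAddCommGroup P] {Γ : Z × P → ℝ → Z} {C : ℝ}
    (hC : ∀ᶠ w in 𝓝 0, ∀ t ∈ Icc (0 : ℝ) 1, ‖Γ w t‖ ≤ C * ‖w‖) {p : Z → Prop}
    (hp : ∀ᶠ z in 𝓝 0, p z) : ∀ᶠ w in 𝓝 0, ∀ t ∈ Icc (0 : ℝ) 1, p (Γ w t) := by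
  obtain ⟨r, hr, hrp⟩ := Metric.eventually_nhds_iff.1 hp
  have hlim : Tendsto (fun w : Z × P ↦ C * ‖w‖) (𝓝 0) (𝓝 0) := by
    have hc : Continuous fun w : Z × P ↦ C * ‖w‖ := by fun_prop
    simpa using hc.tendsto 0
  filter_upwards [hC, hlim.eventually (gt_mem_nhds hr)] with w hw hwr t ht
  exact hrp (by simpa using (hw t ht).trans_lt hwr)

/-- A map that sends the vector fields `v · l` to the vector fields `v' · l` intertwines their
flows. -/
theorem eventually_map_flow_eq {v : Z → P →L[ℝ] Z} {v' : Z' → P →L[ℝ] Z'}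
    (hv' : LipschitzNear v' 0) {Ψ : Z → Z'} (hΨ0 : Ψ 0 = 0)
    (hΨ : ∀ᶠ z in 𝓝 0, DifferentiableAt ℝ Ψ z)
    (hlift : ∀ᶠ z in 𝓝 0, ∀ l, fderiv ℝ Ψ z (v z l) = v' (Ψ z) l)
    {Γ : Z × P → ℝ → Z} {Γ' : Z' × P → ℝ → Z'} {C C' : ℝ}
    (hΓ : ∀ᶠ w in 𝓝 0, Γ w 0 = w.1 ∧
      ∀ t ∈ Icc (0 : ℝ) 1, HasDerivWithinAt (Γ w) (v (Γ w t) w.2) (Icc 0 1) t)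
    (hC : ∀ᶠ w in 𝓝 0, ∀ t ∈ Icc (0 : ℝ) 1, ‖Γ w t‖ ≤ C * ‖w‖)
    (hΓ' : ∀ᶠ w in 𝓝 0, Γ' w 0 = w.1 ∧
      ∀ t ∈ Icc (0 : ℝ) 1, HasDerivWithinAt (Γ' w) (v' (Γ' w t) w.2) (Icc 0 1) t)
    (hC' : ∀ᶠ w in 𝓝 0, ∀ t ∈ Icc (0 : ℝ) 1, ‖Γ' w t‖ ≤ C' * ‖w‖) :
    ∀ᶠ w in 𝓝 0, Ψ (Γ w 1) = Γ' (Ψ w.1, w.2) 1 := by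
  obtain ⟨U, hU, K, hK⟩ := hv'
  have hcont : Tendsto Ψ (𝓝 0) (𝓝 0) := by
    simpa [hΨ0] using hΨ.self_of_nhds.continuousAt.tendsto
  have hpair : Tendsto (fun w : Z × P ↦ (Ψ w.1, w.2)) (𝓝 0) (𝓝 0) :=
    (hcont.comp (continuous_fst.tendsto (0 : Z × P))).prodMk_nhds
      (continuous_snd.tendsto (0 : Z × P))
  have h1 := eventually_forall_Icc_of_norm_le hC
    ((hΨ.and hlift).and (hcont.eventually_mem hU))
  have h2 := hpair.eventually (eventually_forall_Icc_of_norm_le hC' hU)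
  filter_upwards [hΓ, hpair.eventually hΓ', h1, h2] with w ⟨hw0, hw⟩ ⟨hw0', hw'⟩ hm hm'
  have hderiv : ∀ t ∈ Icc (0 : ℝ) 1,
      HasDerivWithinAt (fun t ↦ Ψ (Γ w t)) (v' (Ψ (Γ w t)) w.2) (Icc 0 1) t := fun t ht ↦ by
    have := (hm t ht).1.1.hasFDerivAt.comp_hasDerivWithinAt t (hw t ht)
    rwa [(hm t ht).1.2] at this
  have hright : ∀ t ∈ Ico (0 : ℝ) 1, Icc (0 : ℝ) 1 ∈ 𝓝[Ici t] t := fun t ht ↦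
    Icc_mem_nhdsGE_of_mem ht
  -- Both curves solve the equation of `v' · l` downstairs with the same start, so only the
  -- Lipschitz property of `v'` is needed.
  refine ODE_solution_unique_of_mem_Icc_right (v := fun _ z ↦ v' z w.2) (s := fun _ ↦ U)
    (K := K * ‖w.2‖₊) (fun t _ ↦ ?_) (fun t ht ↦ (hderiv t ht).continuousWithinAt)
    (fun t ht ↦ (hderiv t (Ico_subset_Icc_self ht)).mono_of_mem_nhdsWithin (hright t ht))
    (fun t ht ↦ (hm t (Ico_subset_Icc_self ht)).2) (fun t ht ↦ (hw' t ht).continuousWithinAt)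
    (fun t ht ↦ (hw' t (Ico_subset_Icc_self ht)).mono_of_mem_nhdsWithin (hright t ht))
    (fun t ht ↦ hm' t (Ico_subset_Icc_self ht)) (by simp only [hw0, hw0'])
    (right_mem_Icc.2 zero_le_one)
  refine LipschitzOnWith.of_dist_le_mul fun x hx y hy ↦ ?_
  rw [dist_eq_norm, dist_eq_norm, ← sub_apply]
  refine (ContinuousLinearMap.le_opNorm _ _).trans ?_
  push_cast
  rw [mul_right_comm]
  gcongr
  exact hK.norm_sub_le hx hy

end Conjugacy

/-! ### Trivialisation of a deformation by flows over the parameter space -/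

section Product

open Set Filter

variable {n p k : ℕ}

@[simp] theorem prFst_pt (x : Euc n) (y : Euc k) : prFst (pt x y) = x := rfl

@[simp] theorem prSnd_pt (x : Euc n) (y : Euc k) : prSnd (pt x y) = y := rfl

@[simp] theorem pt_prFst_prSnd (z : EucProd n k) : pt (prFst z) (prSnd z) = z := by
  ext (i | i) <;> rfl

/-- `pt` as a continuous linear map. -/
def ptCLM (n k : ℕ) : Euc n × Euc k →L[ℝ] EucProd n k :=
  LinearMap.toContinuousLinearMap
    { toFun := fun w ↦ pt w.1 w.2
      map_add' := fun _ _ ↦ by ext (i | i) <;> rfl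
      map_smul' := fun _ _ ↦ by ext (i | i) <;> rfl }

@[simp] theorem ptCLM_apply (w : Euc n × Euc k) : ptCLM n k w = pt w.1 w.2 := rfl

/-- `prFst` as a continuous linear map. -/
def prFstCLM (n k : ℕ) : EucProd n k →L[ℝ] Euc n :=
  LinearMap.toContinuousLinearMap
    { toFun := prFst
      map_add' := fun _ _ ↦ rfl
      map_smul' := fun _ _ ↦ rfl }

@[simp] theorem prFstCLM_apply (z : EucProd n k) : prFstCLM n k z = prFst z := rfl

/-- `prSnd` as a continuous linear map. -/
def prSndCLM (n k : ℕ) : EucProd n k →L[ℝ] Euc k :=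
  LinearMap.toContinuousLinearMap
    { toFun := prSnd
      map_add' := fun _ _ ↦ rfl
      map_smul' := fun _ _ ↦ rfl }

@[simp] theorem prSndCLM_apply (z : EucProd n k) : prSndCLM n k z = prSnd z := rfl

/-- The family of vector fields `∑ i, l i • (ξ i + ∂/∂λ_i)`, parametrised by `l`. -/
def paramFields (ξ : Fin k → EucProd n k → Euc n) (z : EucProd n k) : Euc k →L[ℝ] EucProd n k :=
  ∑ i, (EuclideanSpace.proj i : Euc k →L[ℝ] ℝ).smulRight (addParamField (ξ i) i z)

theorem paramFields_apply (ξ : Fin k → EucProd n k → Euc n) (z : EucProd n k) (l : Euc k) :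
    paramFields ξ z l = ∑ i, l i • addParamField (ξ i) i z := by
  simp [paramFields]

theorem prSnd_paramFields (ξ : Fin k → EucProd n k → Euc n) (z : EucProd n k) (l : Euc k) :
    prSnd (paramFields ξ z l) = l := by
  rw [paramFields_apply, ← prSndCLM_apply, map_sum]
  ext j
  simp [addParamField, Finset.sum_apply, Pi.single_apply]

theorem LipschitzNear.paramFields {ξ : Fin k → EucProd n k → Euc n} {a : EucProd n k}
    (hξ : ∀ i, LipschitzNear (addParamField (ξ i) i) a) : LipschitzNear (paramFields ξ) a :=
  LipschitzNear.sum _ fun i _ ↦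
    (hξ i).clm_comp (ContinuousLinearMap.smulRightL ℝ (Euc k) (EucProd n k)
      (EuclideanSpace.proj i : Euc k →L[ℝ] ℝ))

/-- The fields `paramFields ξ` carry `(x, 0)` to `(h (x, l), l)` in time one. -/
theorem exists_flow_paramFields {ξ : Fin k → EucProd n k → Euc n}
    (hξ : ∀ i, LipschitzNear (addParamField (ξ i) i) 0) :
    ∃ (Γ : EucProd n k × Euc k → ℝ → EucProd n k) (h : Euc n × Euc k → Euc n)
      (X : Euc k →L[ℝ] Euc n),
      (∀ᶠ w in 𝓝 0, Γ w 0 = w.1 ∧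
        ∀ t ∈ Icc (0 : ℝ) 1, HasDerivWithinAt (Γ w) (paramFields ξ (Γ w t) w.2) (Icc 0 1) t) ∧
      (∃ C : ℝ, ∀ᶠ w in 𝓝 0, ∀ t ∈ Icc (0 : ℝ) 1, ‖Γ w t‖ ≤ C * ‖w‖) ∧
      h 0 = 0 ∧
      HasStrictFDerivAt h (ContinuousLinearMap.fst ℝ (Euc n) (Euc k) +
        X.comp (ContinuousLinearMap.snd ℝ (Euc n) (Euc k))) 0 ∧
      ∀ᶠ w : Euc n × Euc k in 𝓝 0, Γ (pt w.1 0, w.2) 1 = pt (h w) w.2 := by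
  obtain ⟨Γ, hΓ, ⟨C, hC⟩, hd⟩ := exists_flow_hasStrictFDerivAt (LipschitzNear.paramFields hξ)
  let J : Euc n × Euc k →L[ℝ] EucProd n k × Euc k :=
    ((ptCLM n k).comp ((ContinuousLinearMap.fst ℝ (Euc n) (Euc k)).prod 0)).prod
      (ContinuousLinearMap.snd ℝ (Euc n) (Euc k))
  have hJ : ∀ w, J w = (pt w.1 0, w.2) := fun w ↦ rfl
  refine ⟨Γ, fun w ↦ prFst (Γ (pt w.1 0, w.2) 1), (prFstCLM n k).comp (paramFields ξ 0), hΓ,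
    ⟨C, hC⟩, ?_, ?_, ?_⟩
  · have h0 := hC.self_of_nhds 1 (right_mem_Icc.2 zero_le_one)
    rw [norm_zero, mul_zero, norm_le_zero_iff] at h0
    have : (pt ((0 : Euc n × Euc k).1) 0, (0 : Euc n × Euc k).2)
        = (0 : EucProd n k × Euc k) := by rw [← hJ, map_zero]
    simp only [this, h0]
    exact map_zero (prFstCLM n k)
  · have h1 : HasStrictFDerivAt (fun w ↦ Γ w 1)
        (ContinuousLinearMap.fst ℝ (EucProd n k) (Euc k) + (paramFields ξ 0).comp
          (ContinuousLinearMap.snd ℝ (EucProd n k) (Euc k))) (J 0) := by rw [map_zero]; exact hd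
    have h2 := h1.comp (0 : Euc n × Euc k) J.hasStrictFDerivAt
    have h3 := (prFstCLM n k).hasStrictFDerivAt.comp (0 : Euc n × Euc k) h2
    refine h3.congr_fderiv (ContinuousLinearMap.ext fun w ↦ ?_)
    simp only [ContinuousLinearMap.comp_apply, add_apply, ContinuousLinearMap.coe_fst',
      ContinuousLinearMap.coe_snd', hJ, map_add, prFstCLM_apply, prFst_pt]
  · have hJ0 : Tendsto J (𝓝 0) (𝓝 0) := by simpa using J.continuous.tendsto 0
    filter_upwards [hJ0.eventually hΓ] with w ⟨hw0, hw⟩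
    rw [hJ] at hw0 hw
    set γ := Γ (pt w.1 0, w.2)
    -- The parameter component of the field is the constant `l`, so the flow starting over 0 lies
    -- over `t • l` at time `t`.
    have hder : ∀ t ∈ Icc (0 : ℝ) 1,
        HasDerivWithinAt (fun t ↦ prSnd (γ t) - t • w.2) 0 (Icc 0 1) t := fun t ht ↦ by
      have h1 := ((prSndCLM n k).hasFDerivAt.comp_hasDerivWithinAt t (hw t ht)).sub
        ((hasDerivWithinAt_id t (Icc 0 1)).smul_const w.2)
      refine h1.congr_deriv ?_
      rw [prSndCLM_apply, prSnd_paramFields, one_smul, sub_self]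
    have h2 := (convex_Icc (0 : ℝ) 1).norm_image_sub_le_of_norm_hasDerivWithin_le (C := 0) hder
      (by simp) (left_mem_Icc.2 zero_le_one) (right_mem_Icc.2 zero_le_one)
    rw [zero_mul, norm_le_zero_iff, hw0, prSnd_pt, one_smul, zero_smul, sub_zero, sub_zero,
      sub_eq_zero] at h2
    rw [← h2, pt_prFst_prSnd]

/-- A Lipschitz trivial deformation is trivialised by families of homeomorphisms `h` and `κ` that
are strictly differentiable at the origin. -/
theorem IsLipschitzTrivial.exists_trivialization {f : Euc n → Euc p} {Φ : EucProd n k → Euc p}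
    (hΦ : IsLipschitzTrivial f Φ) :
    ∃ (h : Euc n × Euc k → Euc n) (κ : Euc p × Euc k → Euc p) (X : Euc k →L[ℝ] Euc n)
      (H : Euc k →L[ℝ] Euc p), h 0 = 0 ∧ κ 0 = 0 ∧
      HasStrictFDerivAt h (ContinuousLinearMap.fst ℝ (Euc n) (Euc k) +
        X.comp (ContinuousLinearMap.snd ℝ (Euc n) (Euc k))) 0 ∧
      HasStrictFDerivAt κ (ContinuousLinearMap.fst ℝ (Euc p) (Euc k) +
        H.comp (ContinuousLinearMap.snd ℝ (Euc p) (Euc k))) 0 ∧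
      ∀ᶠ w : Euc n × Euc k in 𝓝 0, Φ (pt (h w) w.2) = κ (f w.1, w.2) := by
  obtain ⟨⟨-, hdef⟩, S, T, -, -, ⟨hΨ0, U, hUo, hU0, hUs, -⟩, -, ξ, η, hξη⟩ := hΦ
  obtain ⟨Γ, h, X, hΓ, ⟨C, hC⟩, h0, hX, hh⟩ := exists_flow_paramFields fun i ↦ (hξη i).1.1
  have hη : ∀ i, LipschitzNear (addParamField (η i) i) 0 := fun i ↦ (hξη i).2.1.1
  obtain ⟨Γ', κ, H, hΓ', ⟨C', hC'⟩, κ0, hH, hκ⟩ := exists_flow_paramFields hη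
  refine ⟨h, κ, X, H, h0, κ0, hX, hH, ?_⟩
  have hΨd : ∀ᶠ z in 𝓝 0, DifferentiableAt ℝ (withParam Φ) z :=
    (hUo.eventually_mem hU0).mono fun z hz ↦
      (hUs.contDiffAt (hUo.mem_nhds hz)).differentiableAt (by simp)
  have hlift : ∀ᶠ z in 𝓝 0, ∀ l,
      fderiv ℝ (withParam Φ) z (paramFields ξ z l) = paramFields η (withParam Φ z) l := by
    filter_upwards [eventually_all.2 fun i ↦ (hξη i).2.2] with z hz l
    simp only [paramFields_apply, map_sum, map_smul, hz]
  have key := eventually_map_flow_eq (LipschitzNear.paramFields hη) hΨ0 hΨd hlift hΓ hC hΓ' hC'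
  have hpt : Tendsto (fun w : Euc n × Euc k ↦ ((pt w.1 0, w.2) : EucProd n k × Euc k))
      (𝓝 0) (𝓝 0) := by
    have hc : Continuous fun w : Euc n × Euc k ↦ (ptCLM n k (w.1, 0), w.2) := by fun_prop
    have h1 := hc.tendsto 0
    have h2 : (ptCLM n k ((0 : Euc n × Euc k).1, 0), (0 : Euc n × Euc k).2) = 0 := by
      rw [Prod.fst_zero, ← Prod.zero_eq_mk, map_zero]; rfl
    rwa [h2] at h1
  have hfst : Tendsto (Prod.fst : Euc n × Euc k → Euc n) (𝓝 0) (𝓝 0) :=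
    continuous_fst.tendsto 0
  -- Over λ = 0 the deformation is `f`, which identifies the starting point of the image curve.
  have hΨpt : ∀ᶠ w : Euc n × Euc k in 𝓝 0, withParam Φ (pt w.1 0) = pt (f w.1) 0 :=
    (hfst.eventually hdef).mono fun w hw ↦ by rw [withParam, hw, prSnd_pt]
  have hf0 : Tendsto (fun w : Euc n × Euc k ↦ (f w.1, w.2)) (𝓝 0) (𝓝 0) := by
    have h1 : Tendsto (fun w : Euc n × Euc k ↦ (prFst (withParam Φ (pt w.1 0)), w.2))
        (𝓝 0) (𝓝 0) := by
      have h3 : Tendsto (fun w : Euc n × Euc k ↦ (pt w.1 0 : EucProd n k)) (𝓝 0) (𝓝 0) :=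
        (continuous_fst.tendsto (0 : EucProd n k × Euc k)).comp hpt
      have h4 : Tendsto (withParam Φ) (𝓝 0) (𝓝 0) := by
        simpa [hΨ0] using hΨd.self_of_nhds.continuousAt.tendsto
      have h5 : Tendsto (prFst : EucProd p k → Euc p) (𝓝 0) (𝓝 0) := by
        have h6 := (prFstCLM p k).continuous.tendsto 0
        rwa [map_zero] at h6
      exact ((h5.comp h4).comp h3).prodMk_nhds (continuous_snd.tendsto (0 : Euc n × Euc k))
    refine h1.congr' (hΨpt.mono fun w hw ↦ ?_)
    rw [hw, prFst_pt]
  filter_upwards [hpt.eventually key, hh, hf0.eventually hκ, hΨpt] with w hw hhw hκw hfw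
  rw [hhw, hfw, hκw] at hw
  exact congrArg prFst hw

end Product

/-! ### Choice of the linear map C -/

section LinearAlgebra

open Module

/-- If the ranges of `S` and `T` span, then some perturbation `S + T C` of `S` is injective. -/
theorem exists_injective_add_comp {K V W : Type*} [Field K] [AddCommGroup V] [Module K V]
    [FiniteDimensional K V] [AddCommGroup W] [Module K W] (S : V →ₗ[K] V) (T : W →ₗ[K] V)
    (h : LinearMap.range S ⊔ LinearMap.range T = ⊤) :
    ∃ C : V →ₗ[K] W, Function.Injective (S + T ∘ₗ C) := by
  set R := LinearMap.range S
  have hsurj : LinearMap.range (R.mkQ ∘ₗ T) = ⊤ := by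
    rw [LinearMap.range_comp]
    have h1 : (R ⊔ LinearMap.range T).map R.mkQ = ⊤ := by
      rw [h, Submodule.map_top, Submodule.range_mkQ]
    rwa [Submodule.map_sup, Submodule.mkQ_map_self, bot_sup_eq] at h1
  obtain ⟨σ, hσ⟩ := (R.mkQ ∘ₗ T).exists_rightInverse_of_surjective hsurj
  have hdim : finrank K (LinearMap.ker S) = finrank K (V ⧸ R) := by
    have h1 := LinearMap.finrank_range_add_finrank_ker S
    have h2 := R.finrank_quotient_add_finrank
    change finrank K R + _ = _ at h1
    omega
  let e := LinearEquiv.ofFinrankEq _ _ hdim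
  obtain ⟨π, hπ⟩ := (LinearMap.ker S).subtype.exists_leftInverse_of_injective
    (LinearMap.ker S).ker_subtype
  -- The kernel of `S` and the quotient by its range have equal dimension; `C` sends the kernel
  -- isomorphically onto that quotient, lifted through `T`. Modulo the range of `S`, the equation `S
  -- x + T (C x) = 0` gives `π x = 0`; then `S x = 0`, and `π` is the identity on the kernel.
  refine ⟨σ ∘ₗ e.toLinearMap ∘ₗ π, (injective_iff_map_eq_zero _).2 fun x hx ↦ ?_⟩
  have h1 : S x + T (σ (e (π x))) = 0 := hx
  have h2 : R.mkQ (S x) = 0 := by simp [R]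
  have h3 : R.mkQ (T (σ (e (π x)))) = e (π x) := LinearMap.congr_fun hσ (e (π x))
  have h4 : e (π x) = 0 := by
    have := congrArg R.mkQ h1
    rwa [map_add, h2, h3, zero_add, map_zero] at this
  have h5 : π x = 0 := by simpa using h4
  have h6 : x ∈ LinearMap.ker S := by
    rw [LinearMap.mem_ker, ← h1, h5, map_zero, map_zero, map_zero, add_zero]
  have h7 : π x = ⟨x, h6⟩ := LinearMap.congr_fun hπ ⟨x, h6⟩
  simpa [h5] using congrArg Subtype.val h7.symm

/-- For endomorphisms `A`, `B` some `(1 - A B) C - A` is injective. -/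
theorem exists_injective_one_sub_mul_sub {V : Type*} [NormedAddCommGroup V] [NormedSpace ℝ V]
    [FiniteDimensional ℝ V] (A B : V →L[ℝ] V) :
    ∃ C : V →L[ℝ] V, ∀ y, C y - A (y + B (C y)) = 0 → y = 0 := by
  obtain ⟨C, hC⟩ := exists_injective_add_comp (-A : V →L[ℝ] V).toLinearMap
    (ContinuousLinearMap.id ℝ V - A.comp B).toLinearMap <| by
      -- The spanning identity is x = (-A)(-B x) + (1 - A B) x.
      refine eq_top_iff.2 fun x _ ↦ Submodule.mem_sup.2
        ⟨_, LinearMap.mem_range_self _ (-B x), _, LinearMap.mem_range_self _ x, by simp⟩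
  refine ⟨LinearMap.toContinuousLinearMap C, fun y hy ↦
    (injective_iff_map_eq_zero _).1 hC y ?_⟩
  rw [← hy]
  simp
  abel

end LinearAlgebra

/-! ### Inverse function theorem for strictly differentiable germs -/

section InverseGerms

open Filter

/-- A germ that is strictly differentiable at the origin with injective derivative is a germ of
bi-Lipschitz homeomorphism. -/
theorem HasStrictFDerivAt.isBiLipschitzGerm {E : Type*} [NormedAddCommGroup E] [NormedSpace ℝ E]
    [FiniteDimensional ℝ E] {a : E → E} {a' : E →L[ℝ] E} (ha : HasStrictFDerivAt a a' 0)
    (h0 : a 0 = 0) (hinj : ∀ x, a' x = 0 → x = 0) : IsBiLipschitzGerm a := by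
  have : CompleteSpace E := FiniteDimensional.complete ℝ E
  let e : E ≃L[ℝ] E := (LinearEquiv.ofInjectiveEndo a'.toLinearMap
    ((injective_iff_map_eq_zero _).2 hinj)).toContinuousLinearEquiv
  have he : HasStrictFDerivAt a (e : E →L[ℝ] E) 0 := ha.congr_fderiv (by ext x; rfl)
  have hb := he.to_localInverse
  have hr := he.eventually_right_inverse
  have hb0 := he.localInverse_apply_image
  rw [h0] at hb hr hb0
  obtain ⟨K, U, hU, hK⟩ := ha.exists_lipschitzOnWith
  obtain ⟨L, V, hV, hL⟩ := hb.exists_lipschitzOnWith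
  exact ⟨h0, ⟨U, hU, K, hK⟩, _, hb0, ⟨V, hV, L, hL⟩, he.eventually_left_inverse, hr⟩

/-- The family of inverses of a family `h (·, l)` of germs whose derivative at the origin is the
identity. -/
theorem exists_fiberwise_inverse {E P : Type*} [NormedAddCommGroup E] [NormedSpace ℝ E]
    [CompleteSpace E] [NormedAddCommGroup P] [NormedSpace ℝ P] [CompleteSpace P]
    {h : E × P → E} {X : P →L[ℝ] E} (h0 : h 0 = 0)
    (hh : HasStrictFDerivAt h (ContinuousLinearMap.fst ℝ E P +
      X.comp (ContinuousLinearMap.snd ℝ E P)) 0) :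
    ∃ m : E × P → E, m 0 = 0 ∧
      HasStrictFDerivAt m (ContinuousLinearMap.fst ℝ E P -
        X.comp (ContinuousLinearMap.snd ℝ E P)) 0 ∧
      (∀ᶠ w in 𝓝 0, m (h w, w.2) = w.1) ∧ ∀ᶠ w in 𝓝 0, h (m w, w.2) = w.1 := by
  -- The derivative of (x, l) ↦ (h(x, l), l) is unipotent triangular, so changing the sign of `X`
  -- inverts it.
  let e : (E × P) ≃L[ℝ] (E × P) := ContinuousLinearEquiv.equivOfInverse
    ((ContinuousLinearMap.fst ℝ E P + X.comp (ContinuousLinearMap.snd ℝ E P)).prod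
      (ContinuousLinearMap.snd ℝ E P))
    ((ContinuousLinearMap.fst ℝ E P - X.comp (ContinuousLinearMap.snd ℝ E P)).prod
      (ContinuousLinearMap.snd ℝ E P))
    (fun w ↦ by simp) (fun w ↦ by simp)
  have he : HasStrictFDerivAt (fun w ↦ (h w, w.2)) (e : E × P →L[ℝ] E × P) 0 :=
    hh.prodMk hasStrictFDerivAt_snd
  have hm := he.to_localInverse
  have hl := he.eventually_left_inverse
  have hr := he.eventually_right_inverse
  have hm0 := he.localInverse_apply_image
  have hz : (h 0, (0 : E × P).2) = 0 := by rw [h0]; rfl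
  rw [hz] at hm hr hm0
  set m := he.localInverse _ _ _
  refine ⟨fun w ↦ (m w).1, by simp only [hm0, Prod.fst_zero], ?_,
    hl.mono fun w hw ↦ by simp only [hw], hr.mono fun w hw ↦ ?_⟩
  · exact (hasStrictFDerivAt_fst.comp (0 : E × P) hm).congr_fderiv (by ext w <;> simp [e])
  · have h1 : (h (m w), (m w).2) = w := hw
    -- The local inverse preserves the parameter because the map being inverted does.
    have h2 : (m w).2 = w.2 := (Prod.ext_iff.1 h1).2
    change h ((m w).1, w.2) = w.1
    rw [← h2]
    exact (Prod.ext_iff.1 h1).1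

theorem IsSmoothMapGerm.hasStrictFDerivAt {E F : Type*} [NormedAddCommGroup E] [NormedSpace ℝ E]
    [NormedAddCommGroup F] [NormedSpace ℝ F] {f : E → F} (hf : IsSmoothMapGerm f) :
    HasStrictFDerivAt f (fderiv ℝ f 0) 0 :=
  let ⟨⟨_, hU, h⟩, _⟩ := hf
  (h.contDiffAt hU).hasStrictFDerivAt (by simp)

theorem IsBiLipschitzGerm.exists_symm {E : Type*} [NormedAddCommGroup E] {a : E → E}
    (ha : IsBiLipschitzGerm a) :
    ∃ b : E → E, IsBiLipschitzGerm b ∧ ∀ᶠ x in 𝓝 0, b (a x) = x :=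
  let ⟨ha0, haL, b, hb0, hbL, hba, hab⟩ := ha
  ⟨b, ⟨hb0, hbL, a, ha0, haL, hab, hba⟩, hba⟩

end InverseGerms

end

/-! ### Construction of the equivalence -/

open Filter in
theorem theorem1 (n p : ℕ) (f g : Euc n → Euc p)
    (hf : IsSmoothMapGerm f) (hg : IsSmoothMapGerm g)
    (s s' : Euc n → Euc n) (hs : IsSmoothDiffeoGerm s s')
    (M : Euc n → (Euc p ≃L[ℝ] Euc p))
    (hM : SmoothNear (fun x => (M x : Euc p →L[ℝ] Euc p)) 0)
    (hfg : ∀ᶠ x in 𝓝 0, f x = M x (g (s x)))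
    (hF : IsLipschitzTrivial f (fun z : EucProd n p => f (prFst z) - M (prFst z) (prSnd z)))
    (hG : IsLipschitzTrivial g (fun z : EucProd n p => g (prFst z) - (M (s' (prFst z))).symm (prSnd z))) :
    BiLipschitzAEquivalent f g := by

  obtain ⟨h₁, κ₁, X₁, H₁, h₁0, κ₁0, hh₁, hκ₁, heq₁⟩ := hF.exists_trivialization
  obtain ⟨h₂, κ₂, X₂, H₂, h₂0, κ₂0, hh₂, hκ₂, heq₂⟩ := hG.exists_trivialization
  obtain ⟨ℓ, ℓ0, hℓ, -, hℓinv⟩ := exists_fiberwise_inverse h₂0 hh₂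
  obtain ⟨m, m0, hm, hminv, -⟩ := exists_fiberwise_inverse κ₂0 hκ₂
  obtain ⟨C, hC⟩ := exists_injective_one_sub_mul_sub H₂ H₁
  obtain ⟨hs₁, hs₂, hss', -⟩ := hs
  have hdf := hf.hasStrictFDerivAt
  have hdg := hg.hasStrictFDerivAt
  have hds := hs₁.hasStrictFDerivAt
  have hds' := hs₂.hasStrictFDerivAt
  have hf0 := hf.2
  have hg0 := hg.2
  have hs0 := hs₁.2
  set A := fderiv ℝ f 0
  set S := fderiv ℝ s 0
  -- Chain rule applied to `s' ∘ s = id`.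
  have hSinj : ∀ x, S x = 0 → x = 0 := fun x hx ↦ by
    have h1 : HasFDerivAt (fun x ↦ s' (s x)) ((fderiv ℝ s' 0).comp S) 0 :=
      HasFDerivAt.comp 0 (by rw [hs0]; exact hds'.hasFDerivAt) hds.hasFDerivAt
    have h2 := (h1.congr_of_eventuallyEq (EventuallyEq.symm hss')).unique (hasFDerivAt_id 0)
    have h3 := DFunLike.congr_fun h2 x
    simpa [hx] using h3.symm
  let y : Euc p → Euc p × Euc p := fun y ↦ (y, C y)
  have hy0 : y 0 = 0 := by simp [y]
  have hdy : HasStrictFDerivAt y ((ContinuousLinearMap.id ℝ (Euc p)).prod C) 0 :=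
    (hasStrictFDerivAt_id 0).prodMk C.hasStrictFDerivAt
  -- For λ = C a, `μ a` is the value of the first deformation and will be the parameter of the
  -- second; `θ` recovers g(z) from the pair (λ, μ).
  let μ : Euc p → Euc p := fun a ↦ κ₁ (y a)
  have hμ0 : μ 0 = 0 := by simp only [μ, hy0, κ₁0]
  have hdμ := HasStrictFDerivAt.comp (g := κ₁) (0 : Euc p) (by rw [hy0]; exact hκ₁) hdy
  let θ : Euc p → Euc p := fun a ↦ m (C a, μ a)
  have hθ0 : θ 0 = 0 := by simp only [θ, hμ0, map_zero]; exact m0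
  have hdθ := HasStrictFDerivAt.comp (g := m) (f := fun a ↦ (C a, μ a)) (0 : Euc p)
    (by rw [map_zero, hμ0]; exact hm) (C.hasStrictFDerivAt.prodMk hdμ)
  -- The derivative of `θ` is C - H₂(1 + H₁C), injective by the choice of `C`.
  have hθinj : IsBiLipschitzGerm θ := hdθ.isBiLipschitzGerm hθ0 fun a ha ↦ hC a (by simpa using ha)
  let a : Euc n → Euc n × Euc p := fun w ↦ (w, C (f w))
  have ha0 : a 0 = 0 := by simp [a, hf0]
  have hCf := HasStrictFDerivAt.comp (g := C) (0 : Euc n) C.hasStrictFDerivAt hdf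
  have hda : HasStrictFDerivAt a _ 0 := (hasStrictFDerivAt_id 0).prodMk hCf
  have hx0 : h₁ (a 0) = 0 := by rw [ha0, h₁0]
  have hdx := HasStrictFDerivAt.comp (g := h₁) (0 : Euc n) (by rw [ha0]; exact hh₁) hda
  have hdsx := HasStrictFDerivAt.comp (g := s) (f := fun w ↦ h₁ (a w)) (0 : Euc n)
    (by rw [hx0]; exact hds) hdx
  have hdμf := HasStrictFDerivAt.comp (g := μ) (0 : Euc n) (by rw [hf0]; exact hdμ) hdf
  let b : Euc n → Euc n × Euc p := fun w ↦ (s (h₁ (a w)), μ (f w))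
  have hb0 : b 0 = 0 := by simp only [b, hx0, hs0, hf0, hμ0]; rfl
  have hdb : HasStrictFDerivAt b _ 0 := hdsx.prodMk hdμf
  let z : Euc n → Euc n := fun w ↦ ℓ (b w)
  have hz0 : z 0 = 0 := by simp only [z, hb0, ℓ0]
  have hdz := HasStrictFDerivAt.comp (g := ℓ) (0 : Euc n) (by rw [hb0]; exact hℓ) hdb
  have hgz := HasStrictFDerivAt.comp (g := g) (f := z) (0 : Euc n) (by rw [hz0]; exact hdg) hdz
  have hθf := HasStrictFDerivAt.comp (g := θ) (0 : Euc n) (by rw [hf0]; exact hdθ) hdf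
  have tendsto_of {E F : Type} [NormedAddCommGroup E] [NormedSpace ℝ E] [NormedAddCommGroup F]
      [NormedSpace ℝ F] {u : E → F} {u' : E →L[ℝ] F} (hu : HasStrictFDerivAt u u' 0)
      (hu0 : u 0 = 0) : Tendsto u (𝓝 0) (𝓝 0) := by
    simpa [hu0] using hu.continuousAt.tendsto
  have hzμ : Tendsto (fun w ↦ (z w, μ (f w))) (𝓝 0) (𝓝 0) :=
    tendsto_of (hdz.prodMk hdμf) (by simp only [hf0, hμ0, hz0]; rfl)
  have hgzμ : Tendsto (fun w ↦ (g (z w), μ (f w))) (𝓝 0) (𝓝 0) :=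
    tendsto_of (hgz.prodMk hdμf) (by simp only [hf0, hμ0, hz0, hg0]; rfl)
  have hx := tendsto_of hdx hx0
  have key : ∀ᶠ w in 𝓝 0, g (z w) = θ (f w) := by
    filter_upwards [(tendsto_of hda ha0).eventually heq₁, hx.eventually hfg, hx.eventually hss',
      (tendsto_of hdb hb0).eventually hℓinv, hzμ.eventually heq₂, hgzμ.eventually hminv]
      with w e₁ e₂ e₃ e₄ e₅ e₆
    simp only [prFst_pt, prSnd_pt, b, a] at e₁ e₂ e₃ e₄ e₅ e₆
    have e₇ : h₂ (z w, μ (f w)) = s (h₁ (w, C (f w))) := e₄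
    -- F(x, λ) = μ for x = h₁(w, λ), rewritten through f = M · (g ∘ s). Solving for λ turns it into
    -- G(s(x), μ) = λ.
    have e₈ : M (h₁ (w, C (f w))) (g (s (h₁ (w, C (f w)))) - C (f w)) = μ (f w) := by
      rw [map_sub, ← e₂, e₁]
    rw [e₇, e₃, ← e₈, ContinuousLinearEquiv.symm_apply_apply, e₈, sub_sub_cancel] at e₅
    rw [← e₆, ← e₅]
  have hderiv := (hgz.hasFDerivAt.congr_of_eventuallyEq (EventuallyEq.symm key)).unique
    hθf.hasFDerivAt
  -- If dz(w) = 0, then dθ(df(w)) = dg(dz(w)) = 0, so df(w) = 0. All terms of dz(w) except ds(w)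
  -- factor through df(w), hence ds(w) = 0 and w = 0.
  have hzb : IsBiLipschitzGerm z := by
    refine hdz.isBiLipschitzGerm hz0 fun w hw ↦ ?_
    have h1 := DFunLike.congr_fun hderiv w
    rw [ContinuousLinearMap.comp_apply, hw, map_zero] at h1
    have h2 : A w = 0 := hC _ (by simpa using h1.symm)
    exact hSinj w (by simpa [h2] using hw)
  obtain ⟨t, ht, htθ⟩ := hθinj.exists_symm
  refine ⟨z, t, hzb, ht, ?_⟩
  filter_upwards [key, (tendsto_of hdf hf0).eventually htθ] with w hw hw'
  rw [hw, hw']
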